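/- All spaces are real, and $L^1(0,1)$ is the space of real integrable functions on $(0,1)$ with Lebesgue measure. "Operator" means bounded linear operator. Let $X$ be a Banach space with a (not necessarily finite-dimensional) Schauder decomposition $X=\sum_{n=1}^{\infty}\oplus X_n$: the $X_n$ are closed linear subspaces of $X$ and every $x\in X$ has a unique expansion as a norm-convergent series $x=\sum_{n=1}^\infty x_n$ with $x_n\in X_n$ for all $n$. Let $P_n:X\to X_n$, $P_n\big(\sum_k x_k\big)=x_n$, be the associated (automatically bounded) projections. Let $\mathcal P=\{f\in L^1(0,1): f\ge 0,\ \int_0^1 f\,dt=1\}$. For a Banach space $Y$, an operator $S:L^1(0,1)\to Y$ is called *strongly regular* if, whenever a net $(f_i)$ in $\mathcal P$ converges weakly in $L^1(0,1)$ to some $f\in\mathcal P$, one has $\|Sf_i-Sf\|\to 0$; it is called *representable* if there is $g\in L^\infty((0,1);Y)$ such that $Sf=\int_0^1 f(t)g(t)\,dt$ (Bochner integral) for every $f\in L^1(0,1)$. **Proposition 1.1.** Suppose that $T:L^1(0,1)\to X$ is an operator which is not strongly regular, while $P_nT:L^1(0,1)\to X_n$ is strongly regular for every $n\in\mathbb N$.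 Then there exists an operator $D:L^1(0,1)\to L^1(0,1)$ such that $TD:L^1(0,1)\to X$ is not representable, while $P_nTD:L^1(0,1)\to X_n$ is representable for every $n\in\mathbb N$. -/

import Mathlib

open MeasureTheory Filter Topology

/-- The space `L¹(0,1)` of (classes of) real integrable functions on the unit interval. -/
abbrev L1 : Type := Lp ℝ 1 (volume.restrict (Set.Ioo (0 : ℝ) 1))

/-- The probability densities in `L¹(0,1)`. -/
def densities : Set L1 := {f | 0 ≤ f ∧ ∫ t in Set.Ioo (0 : ℝ) 1, f t = 1}

/-- A bounded operator `T : L¹(0,1) → Y` is strongly regular if, for every net of densities that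
converges weakly in `L¹(0,1)` to a density `f`, the images converge in norm to `T f`. A net is a
family indexed by a nonempty directed preorder. (Index types in `Type` suffice to describe the
topology of a space that lives in `Type`, as `L¹(0,1)` does.) -/
def IsStronglyRegular {Y : Type*} [NormedAddCommGroup Y] [NormedSpace ℝ Y]
    (T : L1 →L[ℝ] Y) : Prop :=
  ∀ (ι : Type) [Preorder ι] [IsDirectedOrder ι] [Nonempty ι] (u : ι → L1) (f : L1),
    (∀ i, u i ∈ densities) → f ∈ densities →
    Tendsto (fun i => toWeakSpace ℝ L1 (u i)) atTop (𝓝 (toWeakSpace ℝ L1 f)) →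
    Tendsto (fun i => T (u i)) atTop (𝓝 (T f))

/-- A bounded operator `T : L¹(0,1) → Y` is representable if there is `g ∈ L^∞((0,1); Y)` with
`T f = ∫ f g` (Bochner integral) for all `f`. -/
def IsRepresentable {Y : Type*} [NormedAddCommGroup Y] [NormedSpace ℝ Y]
    (T : L1 →L[ℝ] Y) : Prop :=
  ∃ g : Lp Y ⊤ (volume.restrict (Set.Ioo (0 : ℝ) 1)),
    ∀ f : L1, T f = ∫ t in Set.Ioo (0 : ℝ) 1, f t • g t

section Decomposition

variable {X : Type*} [NormedAddCommGroup X] [NormedSpace ℝ X]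

/-- `X = ∑ ⊕ V n` is a Schauder decomposition: the `V n` are closed subspaces of `X` and every
`x` has a unique expansion `x = ∑ v n`, `v n ∈ V n`, the series converging in norm (in the given
order of summation, not necessarily unconditionally). -/
structure IsSchauderDecomposition (V : ℕ → Submodule ℝ X) : Prop where
  isClosed : ∀ n, IsClosed (V n : Set X)
  existsUnique_expansion : ∀ x : X, ∃! v : ∀ n, V n,
    Tendsto (fun N => ∑ n ∈ Finset.range N, (v n : X)) atTop (𝓝 x)

namespace IsSchauderDecomposition

variable {V : ℕ → Submodule ℝ X}

/-- The sequence of components of `x`. -/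
noncomputable def coord (hV : IsSchauderDecomposition V) (x : X) : ∀ n, V n :=
  (hV.existsUnique_expansion x).choose

theorem tendsto_coord (hV : IsSchauderDecomposition V) (x : X) :
    Tendsto (fun N => ∑ n ∈ Finset.range N, (hV.coord x n : X)) atTop (𝓝 x) :=
  (hV.existsUnique_expansion x).choose_spec.1

theorem coord_eq (hV : IsSchauderDecomposition V) {x : X} {v : ∀ n, V n}
    (h : Tendsto (fun N => ∑ n ∈ Finset.range N, (v n : X)) atTop (𝓝 x)) :
    hV.coord x = v :=
  ((hV.existsUnique_expansion x).choose_spec.2 v h).symm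

/-- The projection onto the `n`-th summand as a linear map. -/
noncomputable def projLinear (hV : IsSchauderDecomposition V) (n : ℕ) : X →ₗ[ℝ] V n where
  toFun x := hV.coord x n
  map_add' x y := by
    have h := (hV.tendsto_coord x).add (hV.tendsto_coord y)
    have e : hV.coord (x + y) = fun n => hV.coord x n + hV.coord y n := by
      apply hV.coord_eq
      simpa [Finset.sum_add_distrib] using h
    rw [e]
  map_smul' c x := by
    have h := (hV.tendsto_coord x).const_smul c
    have e : hV.coord (c • x) = fun n => c • hV.coord x n := by
      apply hV.coord_eq
      simpa [Finset.smul_sum] using h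
    rw [e]; rfl

/-- Sequences of partial sums of convergent expansions, together with their limit, as a closed
subspace of the continuous functions on `ℕ ∪ {∞}`. -/
def partialSums (V : ℕ → Submodule ℝ X) : Submodule ℝ C(OnePoint ℕ, X) where
  carrier := {s | s ((0 : ℕ) : OnePoint ℕ) = 0 ∧
    ∀ n : ℕ, s ((n + 1 : ℕ) : OnePoint ℕ) - s (n : OnePoint ℕ) ∈ V n}
  add_mem' := by
    rintro a b ⟨ha, ha'⟩ ⟨hb, hb'⟩
    refine ⟨by simp [ha, hb], fun n => ?_⟩
    have := (V n).add_mem (ha' n) (hb' n)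
    rwa [sub_add_sub_comm] at this
  zero_mem' := ⟨rfl, fun n => by simp⟩
  smul_mem' := by
    rintro c a ⟨ha, ha'⟩
    refine ⟨by simp [ha], fun n => ?_⟩
    have := (V n).smul_mem c (ha' n)
    rwa [smul_sub] at this

theorem isClosed_partialSums (hV : IsSchauderDecomposition V) :
    IsClosed (partialSums V : Set C(OnePoint ℕ, X)) := by
  have : (partialSums V : Set C(OnePoint ℕ, X)) =
      {s | s ((0 : ℕ) : OnePoint ℕ) = 0} ∩
      ⋂ n : ℕ, {s | s ((n + 1 : ℕ) : OnePoint ℕ) - s (n : OnePoint ℕ) ∈ V n} := by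
    ext s
    simp [partialSums]
  rw [this]
  refine (isClosed_eq (ContinuousEvalConst.continuous_eval_const _) continuous_const).inter
    (isClosed_iInter fun n => (hV.isClosed n).preimage ?_)
  exact (ContinuousEvalConst.continuous_eval_const _).sub
    (ContinuousEvalConst.continuous_eval_const _)

theorem coord_of_mem (hV : IsSchauderDecomposition V) {s : C(OnePoint ℕ, X)}
    (hs : s ∈ partialSums V) (n : ℕ) :
    (hV.coord (s OnePoint.infty) n : X) =
      s ((n + 1 : ℕ) : OnePoint ℕ) - s (n : OnePoint ℕ) := by
  have : hV.coord (s OnePoint.infty) = fun n => ⟨_, hs.2 n⟩ := by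
    apply hV.coord_eq
    simp only
    have h := (OnePoint.continuous_iff_from_nat s).1 s.continuous
    simpa [Finset.sum_range_sub (fun n : ℕ => s (n : OnePoint ℕ)), hs.1] using h
  rw [this]

/-- The projections of a Schauder decomposition of a Banach space are bounded. -/
theorem continuous_projLinear [CompleteSpace X] (hV : IsSchauderDecomposition V) (n : ℕ) :
    Continuous (hV.projLinear n) := by
  have : CompleteSpace (partialSums V) := hV.isClosed_partialSums.completeSpace_coe
  let ev : partialSums V →L[ℝ] X :=
    (ContinuousMap.evalCLM ℝ (OnePoint.infty : OnePoint ℕ)).comp (partialSums V).subtypeL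
  have hev : ∀ s, ev s = s.1 OnePoint.infty := fun s => rfl
  have hinj : ev.ker = ⊥ := by
    refine LinearMap.ker_eq_bot'.2 fun s hs => ?_
    have hz : s.1 OnePoint.infty = 0 := hs
    have h0 : ∀ k : ℕ, s.1 (k : OnePoint ℕ) = 0 := by
      intro k
      induction k with
      | zero => exact s.2.1
      | succ k ih =>
        have h1 := hV.coord_of_mem s.2 k
        have h2 : hV.coord (0 : X) k = 0 := (hV.projLinear k).map_zero
        rw [hz, h2, ih, sub_zero] at h1
        exact h1.symm
    ext x
    induction x using OnePoint.rec with
    | infty => exact hz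
    | coe k => exact h0 k
  have hsurj : ev.range = ⊤ := by
    refine LinearMap.range_eq_top.2 fun x => ?_
    refine ⟨⟨OnePoint.continuousMapMkNat
      (fun N => ∑ n ∈ Finset.range N, (hV.coord x n : X)) x (hV.tendsto_coord x), ?_, ?_⟩, ?_⟩
    · change ∑ n ∈ Finset.range 0, (hV.coord x n : X) = 0
      simp
    · intro n
      change ∑ n ∈ Finset.range (n + 1), (hV.coord x n : X) -
        ∑ n ∈ Finset.range n, (hV.coord x n : X) ∈ V n
      simp [Finset.sum_range_succ]
    · rfl
  let e := ContinuousLinearEquiv.ofBijective ev hinj hsurj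
  rw [continuous_induced_rng]
  have : (Subtype.val ∘ hV.projLinear n : X → X) = fun x =>
      (e.symm x).1 ((n + 1 : ℕ) : OnePoint ℕ) - (e.symm x).1 (n : OnePoint ℕ) := by
    funext x
    rw [← hV.coord_of_mem (e.symm x).2 n]
    have : (e.symm x).1 OnePoint.infty = x :=
      ContinuousLinearEquiv.ofBijective_apply_symm_apply ev hinj hsurj x
    rw [this]; rfl
  rw [this]
  have hc : Continuous fun x => (e.symm x).1 := continuous_subtype_val.comp e.symm.continuous
  exact ((ContinuousEvalConst.continuous_eval_const _).comp hc).sub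
    ((ContinuousEvalConst.continuous_eval_const _).comp hc)

/-- The projection `P n : X → V n` of a Schauder decomposition, `P n (∑ v k) = v n`. -/
noncomputable def proj [CompleteSpace X] (hV : IsSchauderDecomposition V) (n : ℕ) :
    X →L[ℝ] V n :=
  ⟨hV.projLinear n, hV.continuous_projLinear n⟩

end IsSchauderDecomposition

end Decomposition

/-! ### Weak neighbourhoods in the positive cone of `L¹(0,1)` -/

/-- The filter of weak neighbourhoods of `f` within the positive cone of `L¹(0,1)`. -/
noncomputable def posWeakNhds (f : L1) : Filter L1 :=
  comap (toWeakSpace ℝ L1) (𝓝 (toWeakSpace ℝ L1 f)) ⊓ 𝓟 {h | 0 ≤ h}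

/-- The integral over `(0,1)`, as a continuous linear functional. -/
noncomputable def mass : L1 →L[ℝ] ℝ := L1.integralCLM

theorem mass_apply (f : L1) : mass f = ∫ t in Set.Ioo (0 : ℝ) 1, f t := by
  rw [← L1.integral_eq_integral, L1.integral_eq]; rfl

theorem norm_eq_mass {f : L1} (hf : 0 ≤ f) : ‖f‖ = mass f := by
  rw [mass_apply, L1.norm_eq_integral_norm]
  refine integral_congr_ae ?_
  filter_upwards [(Lp.coeFn_nonneg f).2 hf] with t ht
  exact Real.norm_of_nonneg ht

theorem L1_smul_nonneg {c : ℝ} (hc : 0 ≤ c) {f : L1} (hf : 0 ≤ f) : 0 ≤ c • f := by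
  rw [← Lp.coeFn_nonneg] at hf ⊢
  filter_upwards [hf, Lp.coeFn_smul c f] with t ht h
  rw [h]
  exact mul_nonneg hc ht

theorem eventually_nonneg_posWeakNhds (f : L1) : ∀ᶠ h in posWeakNhds f, 0 ≤ h :=
  mem_inf_of_right (mem_principal_self _)

theorem tendsto_posWeakNhds_iff {ι : Type*} {l : Filter ι} {u : ι → L1} {f : L1} :
    Tendsto u l (posWeakNhds f) ↔
      Tendsto (fun i => toWeakSpace ℝ L1 (u i)) l (𝓝 (toWeakSpace ℝ L1 f)) ∧
        ∀ᶠ i in l, 0 ≤ u i := by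
  rw [posWeakNhds, tendsto_inf, tendsto_comap_iff, tendsto_principal]
  rfl

theorem tendsto_toWeakSpace_posWeakNhds (f : L1) :
    Tendsto (toWeakSpace ℝ L1) (posWeakNhds f) (𝓝 (toWeakSpace ℝ L1 f)) :=
  (tendsto_posWeakNhds_iff.1 tendsto_id).1

theorem tendsto_dual_posWeakNhds (φ : L1 →L[ℝ] ℝ) (f : L1) :
    Tendsto φ (posWeakNhds f) (𝓝 (φ f)) :=
  ((WeakBilin.eval_continuous (topDualPairing ℝ L1).flip φ).tendsto _).comp
    (tendsto_toWeakSpace_posWeakNhds f)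

theorem tendsto_affine_posWeakNhds (A : L1 →L[ℝ] L1) (hA : ∀ h, 0 ≤ h → 0 ≤ A h) {b : L1}
    (hb : 0 ≤ b) (f : L1) :
    Tendsto (fun h => A h + b) (posWeakNhds f) (posWeakNhds (A f + b)) := by
  refine tendsto_posWeakNhds_iff.2 ⟨?_, ?_⟩
  · have h1 : Tendsto (fun h => WeakSpace.map A (toWeakSpace ℝ L1 h)) (posWeakNhds f)
        (𝓝 (WeakSpace.map A (toWeakSpace ℝ L1 f))) :=
      ((WeakSpace.map A).continuous.tendsto _).comp (tendsto_toWeakSpace_posWeakNhds f)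
    exact h1.add_const (toWeakSpace ℝ L1 b)
  · filter_upwards [eventually_nonneg_posWeakNhds f] with h hh
    exact add_nonneg (hA h hh) hb

/-! ### The weak oscillation of an operator on the positive cone -/

section Oscillation

variable {Y : Type*} [NormedAddCommGroup Y] [NormedSpace ℝ Y]

/-- The weak-to-norm oscillation at `f` of an operator restricted to the positive cone. -/
noncomputable def weakOsc (T : L1 →L[ℝ] Y) (f : L1) : ℝ :=
  sInf {c | 0 ≤ c ∧ ∀ᶠ h in posWeakNhds f, ‖T h - T f‖ ≤ c}

theorem weakOsc_nonneg (T : L1 →L[ℝ] Y) (f : L1) : 0 ≤ weakOsc T f :=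
  Real.sInf_nonneg fun _ hc => hc.1

theorem weakOsc_le {T : L1 →L[ℝ] Y} {f : L1} {c : ℝ} (hc : 0 ≤ c)
    (h : ∀ᶠ h in posWeakNhds f, ‖T h - T f‖ ≤ c) : weakOsc T f ≤ c :=
  csInf_le ⟨0, fun _ hc => hc.1⟩ ⟨hc, h⟩

theorem eventually_norm_sub_le (T : L1 →L[ℝ] Y) {f : L1} (hf : 0 ≤ f) {ε : ℝ} (hε : 0 < ε) :
    ∀ᶠ h in posWeakNhds f, ‖T h - T f‖ ≤ 2 * ‖T‖ * ‖f‖ + ‖T‖ * ε := by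
  have hm := (tendsto_dual_posWeakNhds mass f).eventually (Iio_mem_nhds (lt_add_of_pos_right _ hε))
  filter_upwards [hm, eventually_nonneg_posWeakNhds f] with h h1 h2
  rw [← norm_eq_mass h2, ← norm_eq_mass hf] at h1
  calc ‖T h - T f‖ ≤ ‖T h‖ + ‖T f‖ := norm_sub_le _ _
    _ ≤ ‖T‖ * ‖h‖ + ‖T‖ * ‖f‖ := add_le_add (T.le_opNorm _) (T.le_opNorm _)
    _ ≤ ‖T‖ * (‖f‖ + ε) + ‖T‖ * ‖f‖ := by gcongr
    _ = _ := by ring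

theorem eventually_of_weakOsc_lt {T : L1 →L[ℝ] Y} {f : L1} (hf : 0 ≤ f) {c : ℝ}
    (h : weakOsc T f < c) : ∀ᶠ h in posWeakNhds f, ‖T h - T f‖ ≤ c := by
  have hne : {c | 0 ≤ c ∧ ∀ᶠ h in posWeakNhds f, ‖T h - T f‖ ≤ c}.Nonempty :=
    ⟨2 * ‖T‖ * ‖f‖ + ‖T‖ * 1, by positivity, eventually_norm_sub_le T hf one_pos⟩
  obtain ⟨b, ⟨-, hb⟩, hbc⟩ := exists_lt_of_csInf_lt hne h
  filter_upwards [hb] with h hh using hh.trans hbc.le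

theorem weakOsc_le_norm (T : L1 →L[ℝ] Y) {f : L1} (hf : 0 ≤ f) :
    weakOsc T f ≤ 2 * ‖T‖ * ‖f‖ := by
  have h : Tendsto (fun ε : ℝ => 2 * ‖T‖ * ‖f‖ + ‖T‖ * ε) (𝓝[>] 0)
      (𝓝 (2 * ‖T‖ * ‖f‖ + ‖T‖ * 0)) :=
    (Continuous.tendsto (by fun_prop) 0).mono_left nhdsWithin_le_nhds
  rw [mul_zero, add_zero] at h
  refine ge_of_tendsto h ?_
  filter_upwards [self_mem_nhdsWithin] with ε hε
  have hε : 0 < ε := hε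
  exact weakOsc_le (by positivity) (eventually_norm_sub_le T hf hε)

theorem weakOsc_mono (T : L1 →L[ℝ] Y) {f g : L1} (hf : 0 ≤ f) (hfg : f ≤ g) :
    weakOsc T f ≤ weakOsc T g := by
  have hg : 0 ≤ g := hf.trans hfg
  refine le_of_forall_gt fun c hc => ?_
  obtain ⟨b, hb, hbc⟩ := exists_between hc
  refine lt_of_le_of_lt (weakOsc_le ((weakOsc_nonneg T g).trans hb.le) ?_) hbc
  have h := tendsto_affine_posWeakNhds (.id ℝ L1) (fun _ h => h) (sub_nonneg.2 hfg) f
  rw [ContinuousLinearMap.id_apply, add_sub_cancel] at h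
  filter_upwards [h.eventually (eventually_of_weakOsc_lt hg hb)] with h hh
  have e : T (h + (g - f)) - T g = T h - T f := by simp only [map_add, map_sub]; abel
  rwa [ContinuousLinearMap.id_apply, e] at hh

theorem weakOsc_smul_le (T : L1 →L[ℝ] Y) {f : L1} (hf : 0 ≤ f) {a : ℝ} (ha : 0 < a) :
    weakOsc T (a • f) ≤ a * weakOsc T f := by
  refine le_of_forall_gt fun c hc => ?_
  obtain ⟨b, hb, hbc⟩ := exists_between hc
  refine lt_of_le_of_lt
    (weakOsc_le ((mul_nonneg ha.le (weakOsc_nonneg T f)).trans hb.le) ?_) hbc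
  have hb' : weakOsc T f < b / a := by rwa [lt_div_iff₀' ha]
  have h := tendsto_affine_posWeakNhds (a⁻¹ • .id ℝ L1)
    (fun _ h => L1_smul_nonneg (inv_nonneg.2 ha.le) h) le_rfl (a • f)
  have e (h : L1) : (a⁻¹ • ContinuousLinearMap.id ℝ L1) h + 0 = a⁻¹ • h := by simp
  simp only [e, inv_smul_smul₀ ha.ne'] at h
  filter_upwards [h.eventually (eventually_of_weakOsc_lt hf hb')] with h hh
  have e : T h - T (a • f) = a • (T (a⁻¹ • h) - T f) := by
    rw [smul_sub, ← map_smul, smul_inv_smul₀ ha.ne', map_smul]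
  rw [e, norm_smul, Real.norm_of_nonneg ha.le]
  rwa [le_div_iff₀' ha] at hh

theorem weakOsc_smul (T : L1 →L[ℝ] Y) {f : L1} (hf : 0 ≤ f) {a : ℝ} (ha : 0 < a) :
    weakOsc T (a • f) = a * weakOsc T f := by
  refine le_antisymm (weakOsc_smul_le T hf ha) ?_
  have := weakOsc_smul_le T (L1_smul_nonneg ha.le hf) (inv_pos.2 ha)
  rwa [inv_smul_smul₀ ha.ne', inv_mul_eq_div, le_div_iff₀' ha] at this

/-- A positive function below another one is obtained from it by a positive multiplication
operator whose complement to the identity is positive. -/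
theorem exists_multiplier {f g : L1} (hf : 0 ≤ f) (hg : 0 ≤ g) :
    ∃ A : L1 →L[ℝ] L1, (∀ h, 0 ≤ h → 0 ≤ A h) ∧ (∀ h, 0 ≤ h → 0 ≤ h - A h) ∧ A (f + g) = f := by
  let m : ℝ → ℝ := fun t => min (max (f t / (f t + g t)) 0) 1
  have hm0 t : 0 ≤ m t := le_min (le_max_right _ _) zero_le_one
  have hm1 t : m t ≤ 1 := min_le_right _ _
  have hmeas : AEStronglyMeasurable m (volume.restrict (Set.Ioo (0 : ℝ) 1)) := by
    have h1 := (Lp.aestronglyMeasurable f).aemeasurable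
    have h2 := (Lp.aestronglyMeasurable g).aemeasurable
    exact (((h1.div (h1.add h2)).max aemeasurable_const).min
      aemeasurable_const).aestronglyMeasurable
  have hmem : MemLp m ⊤ (volume.restrict (Set.Ioo (0 : ℝ) 1)) :=
    memLp_top_of_bound hmeas 1 (.of_forall fun t => by
      rw [Real.norm_of_nonneg (hm0 t)]; exact hm1 t)
  let A : L1 →L[ℝ] L1 := (ContinuousLinearMap.mul ℝ ℝ).holderL
    (volume.restrict (Set.Ioo (0 : ℝ) 1)) ⊤ 1 1 hmem.toLp
  have hA (h : L1) : A h =ᵐ[volume.restrict (Set.Ioo (0 : ℝ) 1)] fun t => m t * h t := by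
    filter_upwards [(ContinuousLinearMap.mul ℝ ℝ).coeFn_holder (r := 1) hmem.toLp h,
      hmem.coeFn_toLp] with t h1 h2
    rw [← h2]; exact h1
  refine ⟨A, fun h hh => ?_, fun h hh => ?_, Lp.ext ?_⟩
  · rw [← Lp.coeFn_nonneg] at hh ⊢
    filter_upwards [hh, hA h] with t h1 h2
    rw [h2]; exact mul_nonneg (hm0 t) h1
  · rw [← Lp.coeFn_nonneg] at hh ⊢
    filter_upwards [hh, hA h, Lp.coeFn_sub h (A h)] with t h1 h2 h3
    rw [h3, Pi.sub_apply, h2]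
    exact sub_nonneg.2 (mul_le_of_le_one_left h1 (hm1 t))
  · rw [← Lp.coeFn_nonneg] at hf hg
    filter_upwards [hf, hg, hA (f + g), Lp.coeFn_add f g] with t h1 h2 h3 h4
    rw [h3, h4, Pi.add_apply]
    simp only [Pi.zero_apply] at h1 h2
    have h5 : 0 ≤ f t / (f t + g t) := by positivity
    have h6 : f t / (f t + g t) ≤ 1 := div_le_one_of_le₀ (by linarith) (by linarith)
    simp only [m, max_eq_left h5, min_eq_left h6]
    rcases eq_or_ne (f t + g t) 0 with h0 | h0
    · rw [h0, mul_zero]; linarith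
    · field_simp

theorem weakOsc_add_le (T : L1 →L[ℝ] Y) {f g : L1} (hf : 0 ≤ f) (hg : 0 ≤ g) :
    weakOsc T (f + g) ≤ weakOsc T f + weakOsc T g := by
  obtain ⟨A, hA, hA', hAf⟩ := exists_multiplier hf hg
  refine le_of_forall_pos_le_add fun ε hε => ?_
  have h1 := tendsto_affine_posWeakNhds A hA le_rfl (f + g)
  have h2 := tendsto_affine_posWeakNhds (ContinuousLinearMap.id ℝ L1 - A) hA' le_rfl (f + g)
  have e : (ContinuousLinearMap.id ℝ L1 - A) (f + g) + 0 = g := by simp [hAf]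
  rw [hAf, add_zero] at h1
  rw [e] at h2
  refine weakOsc_le (add_nonneg (add_nonneg (weakOsc_nonneg T f) (weakOsc_nonneg T g)) hε.le) ?_
  filter_upwards [h1.eventually (eventually_of_weakOsc_lt (T := T) hf (lt_add_of_pos_right _ (half_pos hε))),
    h2.eventually (eventually_of_weakOsc_lt (T := T) hg (lt_add_of_pos_right _ (half_pos hε)))]
    with h h3 h4
  have e : T h - T (f + g) = (T (A h + 0) - T f) +
      (T ((ContinuousLinearMap.id ℝ L1 - A) h + 0) - T g) := by
    simp only [map_add, add_zero, sub_apply, ContinuousLinearMap.id_apply,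
      map_sub]
    abel
  rw [e]
  linarith [norm_add_le (T (A h + 0) - T f) (T ((ContinuousLinearMap.id ℝ L1 - A) h + 0) - T g)]

theorem L1_posPart_nonneg (f : L1) : 0 ≤ Lp.posPart f := by
  rw [← Lp.coeFn_nonneg]
  filter_upwards [Lp.coeFn_posPart f] with t h
  rw [h]; exact le_max_right _ _

theorem L1_posPart_add_le (f g : L1) : Lp.posPart (f + g) ≤ Lp.posPart f + Lp.posPart g := by
  rw [← Lp.coeFn_le]
  filter_upwards [Lp.coeFn_posPart f, Lp.coeFn_posPart g, Lp.coeFn_posPart (f + g),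
    Lp.coeFn_add f g, Lp.coeFn_add (Lp.posPart f) (Lp.posPart g)] with t h1 h2 h3 h4 h5
  rw [h3, h5, h4, Pi.add_apply, Pi.add_apply, h1, h2]
  exact max_le (add_le_add (le_max_left _ _) (le_max_left _ _))
    (add_nonneg (le_max_right _ _) (le_max_right _ _))

theorem L1_posPart_smul {c : ℝ} (hc : 0 ≤ c) (f : L1) : Lp.posPart (c • f) = c • Lp.posPart f := by
  refine Lp.ext ?_
  filter_upwards [Lp.coeFn_posPart f, Lp.coeFn_posPart (c • f), Lp.coeFn_smul c f,
    Lp.coeFn_smul c (Lp.posPart f)] with t h1 h2 h3 h4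
  rw [h2, h3, h4, Pi.smul_apply, Pi.smul_apply, h1, smul_eq_mul, smul_eq_mul,
    mul_max_of_nonneg _ _ hc, mul_zero]

theorem L1_posPart_of_nonneg {f : L1} (hf : 0 ≤ f) : Lp.posPart f = f := by
  refine Lp.ext ?_
  filter_upwards [Lp.coeFn_posPart f, (Lp.coeFn_nonneg f).2 hf] with t h1 h2
  rw [h1]; exact max_eq_left h2

theorem L1_norm_posPart_le (f : L1) : ‖Lp.posPart f‖ ≤ ‖f‖ := by
  refine Lp.norm_le_norm_of_ae_le ?_
  filter_upwards [Lp.coeFn_posPart f] with t h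
  rw [h, Real.norm_of_nonneg (le_max_right _ _)]
  exact max_le (Real.le_norm_self _) (norm_nonneg _)

/-- A positive functional supporting the weak oscillation, by the Hahn–Banach theorem. -/
theorem exists_dual_le_weakOsc (T : L1 →L[ℝ] Y) {f : L1} (hf : 0 ≤ f)
    (hpos : 0 < weakOsc T f) :
    ∃ ψ : L1 →L[ℝ] ℝ, ψ f = weakOsc T f ∧ ∀ h, 0 ≤ h → ψ h ≤ weakOsc T h := by
  have hf0 : f ≠ 0 := by
    rintro rfl
    have := weakOsc_le_norm T hf
    rw [norm_zero, mul_zero] at this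
    exact absurd this (not_le.2 hpos)
  let N : L1 → ℝ := fun h => weakOsc T (Lp.posPart h)
  obtain ⟨ψ, hψ, hψN⟩ := exists_extension_of_le_sublinear
    (LinearPMap.mkSpanSingleton f (weakOsc T f) hf0 : L1 →ₗ.[ℝ] ℝ) N
    (fun c hc h => by
      simp only [N]
      rw [L1_posPart_smul hc.le, weakOsc_smul T (L1_posPart_nonneg h) hc])
    (fun g h => (weakOsc_mono T (L1_posPart_nonneg _) (L1_posPart_add_le g h)).trans
      (weakOsc_add_le T (L1_posPart_nonneg g) (L1_posPart_nonneg h)))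
    (by
      rintro ⟨x, hx⟩
      obtain ⟨c, rfl⟩ := Submodule.mem_span_singleton.1 hx
      rw [LinearPMap.mkSpanSingleton'_apply]
      simp only [N, RingHom.id_apply, smul_eq_mul]
      rcases le_or_gt c 0 with hc | hc
      · exact (mul_nonpos_of_nonpos_of_nonneg hc hpos.le).trans (weakOsc_nonneg _ _)
      · rw [L1_posPart_of_nonneg (L1_smul_nonneg hc.le hf), weakOsc_smul T hf hc])
  have hbound (h : L1) : ψ h ≤ 2 * ‖T‖ * ‖h‖ :=
    ((hψN h).trans (weakOsc_le_norm T (L1_posPart_nonneg h))).trans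
      (by gcongr; exact L1_norm_posPart_le h)
  refine ⟨ψ.mkContinuous (2 * ‖T‖) fun h => ?_, ?_, fun h hh => ?_⟩
  · rw [Real.norm_eq_abs, abs_le]
    have := hbound (-h)
    rw [map_neg, norm_neg] at this
    exact ⟨by linarith, hbound h⟩
  · have := hψ ⟨f, Submodule.mem_span_singleton_self f⟩
    rw [LinearPMap.mkSpanSingleton_apply] at this
    exact this
  · have := hψN h
    simp only [N, L1_posPart_of_nonneg hh] at this
    exact this

end Oscillation

/-! ### Strong regularity in terms of filters -/

section StronglyRegular

variable {Y : Type*} [NormedAddCommGroup Y] [NormedSpace ℝ Y]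

theorem mem_densities_iff {f : L1} : f ∈ densities ↔ 0 ≤ f ∧ mass f = 1 := by
  rw [mass_apply]; rfl

theorem IsStronglyRegular.tendsto_of_mem_densities {T : L1 →L[ℝ] Y} (hT : IsStronglyRegular T)
    {f : L1} (hf : f ∈ densities) :
    Tendsto T (posWeakNhds f ⊓ 𝓟 densities) (𝓝 (T f)) := by
  by_contra hcon
  obtain ⟨V, hV, hfreq⟩ := not_tendsto_iff_exists_frequently_notMem.1 hcon
  set F := posWeakNhds f ⊓ 𝓟 densities with hF
  have hex (U : {U : Set L1 // U ∈ F}ᵒᵈ) : ∃ h, (h ∈ (OrderDual.ofDual U).1 ∧ h ∈ densities) ∧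
      T h ∉ V := by
    have hd : densities ∈ F := mem_inf_of_right (mem_principal_self _)
    obtain ⟨h, h1, h2, h3⟩ :=
      (hfreq.and_eventually (inter_mem (OrderDual.ofDual U).2 hd)).exists
    exact ⟨h, ⟨h2, h3⟩, h1⟩
  choose u hu huV using hex
  have : IsDirectedOrder {U : Set L1 // U ∈ F}ᵒᵈ := ⟨fun U U' =>
    ⟨OrderDual.toDual ⟨_, inter_mem (OrderDual.ofDual U).2 (OrderDual.ofDual U').2⟩,
      Set.inter_subset_left, Set.inter_subset_right⟩⟩
  have : Nonempty {U : Set L1 // U ∈ F}ᵒᵈ := ⟨OrderDual.toDual ⟨_, univ_mem⟩⟩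
  have hlim : Tendsto u atTop F := by
    intro U hU
    refine mem_map.2 ?_
    filter_upwards [eventually_ge_atTop
      (OrderDual.toDual (⟨U, hU⟩ : {U : Set L1 // U ∈ F}))] with i hi
    exact hi (hu i).1
  have h1 := hT _ u f (fun i => (hu i).2) hf
    ((tendsto_toWeakSpace_posWeakNhds f).comp (hlim.mono_right inf_le_left))
  obtain ⟨i, hi⟩ := (h1.eventually hV).exists
  exact huV i hi

theorem IsStronglyRegular.tendsto_posWeakNhds {T : L1 →L[ℝ] Y} (hT : IsStronglyRegular T)
    {f : L1} (hf : 0 ≤ f) (hf0 : f ≠ 0) : Tendsto T (posWeakNhds f) (𝓝 (T f)) := by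
  have hm : 0 < mass f := by rw [← norm_eq_mass hf]; exact norm_pos_iff.2 hf0
  have hmass := tendsto_dual_posWeakNhds mass f
  have hpos : ∀ᶠ h in posWeakNhds f, 0 < mass h := hmass.eventually (Ioi_mem_nhds hm)
  have hdens {h : L1} (h1 : 0 ≤ h) (h2 : 0 < mass h) : (mass h)⁻¹ • h ∈ densities := by
    refine mem_densities_iff.2 ⟨L1_smul_nonneg (inv_nonneg.2 h2.le) h1, ?_⟩
    rw [map_smul, smul_eq_mul, inv_mul_cancel₀ h2.ne']
  have hnorm : Tendsto (fun h => (mass h)⁻¹ • h) (posWeakNhds f)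
      (posWeakNhds ((mass f)⁻¹ • f) ⊓ 𝓟 densities) := by
    refine tendsto_inf.2 ⟨tendsto_posWeakNhds_iff.2 ⟨?_, ?_⟩, tendsto_principal.2 ?_⟩
    · exact (hmass.inv₀ hm.ne').smul (tendsto_toWeakSpace_posWeakNhds f)
    · filter_upwards [hpos, eventually_nonneg_posWeakNhds f] with h h1 h2
      exact L1_smul_nonneg (inv_nonneg.2 h1.le) h2
    · filter_upwards [hpos, eventually_nonneg_posWeakNhds f] with h h1 h2
      exact hdens h2 h1
  have key := hmass.smul ((hT.tendsto_of_mem_densities (hdens hf hm)).comp hnorm)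
  have e : mass f • T ((mass f)⁻¹ • f) = T f := by rw [← map_smul, smul_inv_smul₀ hm.ne']
  rw [e] at key
  refine key.congr' ?_
  filter_upwards [hpos] with h hh
  rw [Function.comp_apply, ← map_smul, smul_inv_smul₀ hh.ne']

theorem exists_weakOsc_pos {T : L1 →L[ℝ] Y} (hT : ¬ IsStronglyRegular T) :
    ∃ f ∈ densities, 0 < weakOsc T f := by
  by_contra! hcon
  refine hT fun ι _ _ _ u f hu hf hlim => ?_
  have hf0 := (mem_densities_iff.1 hf).1
  have hlim' : Tendsto u atTop (posWeakNhds f) :=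
    tendsto_posWeakNhds_iff.2 ⟨hlim, .of_forall fun i => (mem_densities_iff.1 (hu i)).1⟩
  refine Metric.tendsto_nhds.2 fun ε hε => ?_
  filter_upwards [hlim'.eventually (eventually_of_weakOsc_lt (T := T) hf0
    ((hcon f hf).trans_lt (half_pos hε)))] with i hi
  rw [dist_eq_norm]
  exact hi.trans_lt (half_lt_self hε)

end StronglyRegular

/-! ### Approximation of convex combinations by arithmetic means -/

section Averages

variable {E : Type*} [NormedAddCommGroup E] [NormedSpace ℝ E]

/-- The pairs `(N, v)` such that `v` is a sum of `N` elements of `S`. -/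
def countedSums (S : Set E) : AddSubmonoid (ℕ × E) :=
  AddSubmonoid.closure ((fun s => (1, s)) '' S)

omit [NormedSpace ℝ E] in
theorem exists_seq_of_mem_countedSums {S : Set E} (hS : S.Nonempty) {p : ℕ × E}
    (hp : p ∈ countedSums S) : ∃ s : ℕ → E, (∀ i, s i ∈ S) ∧ ∑ i ∈ Finset.range p.1, s i = p.2 := by
  obtain ⟨z, hz⟩ := hS
  induction hp using AddSubmonoid.closure_induction with
  | mem x hx =>
    obtain ⟨s, hs, rfl⟩ := hx
    exact ⟨fun _ => s, fun _ => hs, by simp⟩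
  | zero => exact ⟨fun _ => z, fun _ => hz, by simp⟩
  | add x y _ _ hx hy =>
    obtain ⟨s, hs, hsx⟩ := hx
    obtain ⟨t, ht, hty⟩ := hy
    refine ⟨fun i => if i < x.1 then s i else t (i - x.1), fun i => ?_, ?_⟩
    · dsimp only
      split_ifs
      exacts [hs i, ht _]
    · rw [Prod.fst_add, Finset.sum_range_add, Prod.snd_add, ← hsx, ← hty]
      congr 1
      · exact Finset.sum_congr rfl fun i hi => if_pos (Finset.mem_range.1 hi)
      · exact Finset.sum_congr rfl fun i _ => by simp

/-- The arithmetic means of finite sequences in `S`. -/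
def arithmeticMeans (S : Set E) : Set E :=
  {y | ∃ N : ℕ, 0 < N ∧ (N, N • y) ∈ countedSums S}

omit [NormedSpace ℝ E] in
theorem subset_arithmeticMeans (S : Set E) : S ⊆ arithmeticMeans S := fun s hs =>
  ⟨1, one_pos, by rw [one_smul]; exact AddSubmonoid.subset_closure ⟨s, hs, rfl⟩⟩

theorem rational_combination_mem_arithmeticMeans {S : Set E} {a b : E}
    (ha : a ∈ arithmeticMeans S) (hb : b ∈ arithmeticMeans S) {p q : ℕ} (hq : 0 < q)
    (hpq : p ≤ q) : (1 - (p / q : ℝ)) • a + (p / q : ℝ) • b ∈ arithmeticMeans S := by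
  obtain ⟨N, hN, hNa⟩ := ha
  obtain ⟨M, hM, hMb⟩ := hb
  refine ⟨q * (N * M), by positivity, ?_⟩
  have h := add_mem (nsmul_mem hNa ((q - p) * M)) (nsmul_mem hMb (p * N))
  convert h using 1
  have hq' : (q : ℝ) ≠ 0 := by positivity
  ext
  · simp only [Prod.fst_add, Prod.smul_fst, smul_eq_mul]
    obtain ⟨r, rfl⟩ := Nat.exists_eq_add_of_le hpq
    rw [Nat.add_sub_cancel_left]
    ring
  · simp only [Prod.snd_add, Prod.smul_snd, ← Nat.cast_smul_eq_nsmul ℝ, smul_add, smul_smul]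
    push_cast [Nat.cast_sub hpq]
    congr 2 <;> field_simp

theorem convex_closure_arithmeticMeans (S : Set E) : Convex ℝ (closure (arithmeticMeans S)) := by
  have key (t : ℝ) (ht0 : 0 ≤ t) (ht1 : t ≤ 1) {a b : E} (ha : a ∈ arithmeticMeans S)
      (hb : b ∈ arithmeticMeans S) : (1 - t) • a + t • b ∈ closure (arithmeticMeans S) := by
    have hlim : Tendsto (fun q : ℕ => ((⌊t * (q : ℝ)⌋₊ : ℝ) / (q : ℝ))) atTop (𝓝 t) :=
      (tendsto_nat_floor_mul_div_atTop ht0).comp tendsto_natCast_atTop_atTop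
    refine mem_closure_of_tendsto
      (((tendsto_const_nhds.sub hlim).smul_const a).add (hlim.smul_const b)) ?_
    filter_upwards [eventually_gt_atTop 0] with q hq
    exact rational_combination_mem_arithmeticMeans ha hb hq
      (Nat.floor_le_of_le (mul_le_of_le_one_left q.cast_nonneg ht1))
  intro a ha b hb s t hs ht hst
  obtain rfl : s = 1 - t := by linarith
  have h := map_mem_closure₂ (f := fun a b => (1 - t) • a + t • b)
    (u := closure (arithmeticMeans S)) (by fun_prop) ha hb
    fun a ha b hb => key t ht (by linarith) ha hb
  rwa [closure_closure] at h

theorem exists_mean_near {S : Set E} {g : E} (hg : g ∈ closure (convexHull ℝ S)) {ε : ℝ}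
    (hε : 0 < ε) : ∃ N : ℕ, 0 < N ∧ ∃ s : ℕ → E, (∀ i, s i ∈ S) ∧
      ‖g - (N : ℝ)⁻¹ • ∑ i ∈ Finset.range N, s i‖ < ε := by
  have hS : S.Nonempty := convexHull_nonempty_iff.1 (closure_nonempty_iff.1 ⟨g, hg⟩)
  have hg' : g ∈ closure (arithmeticMeans S) :=
    closure_minimal (convexHull_min ((subset_arithmeticMeans S).trans subset_closure)
      (convex_closure_arithmeticMeans S)) isClosed_closure hg
  obtain ⟨y, ⟨N, hN, hNy⟩, hy⟩ := Metric.mem_closure_iff.1 hg' ε hε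
  obtain ⟨s, hs, hsum⟩ := exists_seq_of_mem_countedSums hS hNy
  refine ⟨N, hN, s, hs, ?_⟩
  have hN' : (N : ℝ) ≠ 0 := by positivity
  simp only at hsum
  rw [hsum, ← Nat.cast_smul_eq_nsmul ℝ, inv_smul_smul₀ hN', ← dist_eq_norm]
  exact hy

end Averages

/-! ### Splitting a node of the tree -/

section Splitting

variable {X : Type*} [NormedAddCommGroup X] [NormedSpace ℝ X]
  {Y : ℕ → Type*} [∀ k, NormedAddCommGroup (Y k)] [∀ k, NormedSpace ℝ (Y k)]

/-- Small perturbations of positive functions on which the functional `ψ` exceeds `δ`. -/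
def treeNodes (ψ : L1 →L[ℝ] ℝ) (δ : ℝ) : Set L1 :=
  {x | ∃ g, 0 ≤ g ∧ δ < ψ g ∧ mass g < 2 ∧ ‖x - g‖ < 1}

theorem norm_le_of_mem_treeNodes {ψ : L1 →L[ℝ] ℝ} {δ : ℝ} {x : L1} (hx : x ∈ treeNodes ψ δ) :
    ‖x‖ ≤ 3 := by
  obtain ⟨g, hg, -, hm, hxg⟩ := hx
  rw [← norm_eq_mass hg] at hm
  linarith [norm_le_norm_add_norm_sub' x g]

theorem mem_closure_convexHull_of_frequently {g : L1} {S : Set L1}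
    (h : ∃ᶠ h in posWeakNhds g, h ∈ S) : g ∈ closure (convexHull ℝ S) := by
  have hw : toWeakSpace ℝ L1 g ∈ closure (toWeakSpace ℝ L1 '' convexHull ℝ S) := by
    refine mem_closure_iff_frequently.2 ((tendsto_toWeakSpace_posWeakNhds g).frequently
      (h.mono fun x hx => ⟨x, subset_convexHull ℝ S hx, rfl⟩))
  rw [← (convex_convexHull ℝ S).toWeakSpace_closure ℝ] at hw
  obtain ⟨x, hx, hxg⟩ := hw
  rwa [← (toWeakSpace ℝ L1).injective hxg]

theorem exists_splitting {T : L1 →L[ℝ] X} {Q : ∀ k, L1 →L[ℝ] Y k} {ψ : L1 →L[ℝ] ℝ} {δ : ℝ}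
    (hδ : 0 < δ) (hψ : ∀ h, 0 ≤ h → ψ h ≤ weakOsc T h)
    (hQ : ∀ k f, 0 ≤ f → f ≠ 0 → Tendsto (Q k) (posWeakNhds f) (𝓝 (Q k f)))
    {x : L1} (hx : x ∈ treeNodes ψ δ) (n : ℕ) {η : ℝ} (hη : 0 < η) :
    ∃ y : ℕ → L1, (Set.range y).Finite ∧ (∀ i, y i ∈ treeNodes ψ δ) ∧
      (∀ i, δ / 2 ≤ ‖T (y i) - T x‖) ∧ (∀ i, ∀ k < n, ‖Q k (y i) - Q k x‖ ≤ η) ∧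
      ∃ N₀ : ℕ, 0 < N₀ ∧ ∀ N, N₀ ∣ N → ∑ i ∈ Finset.range N, y i = N • x := by
  obtain ⟨g, hg, hψg, hmg, hxg⟩ := hx
  have hg0 : g ≠ 0 := by
    rintro rfl
    rw [map_zero] at hψg
    linarith
  let S : Set L1 := {h | 0 ≤ h ∧ δ < ψ h ∧ mass h < 2 ∧ δ < ‖T h - T g‖ ∧
    ∀ k < n, ‖Q k h - Q k g‖ < η / 2}
  have hfreq : ∃ᶠ h in posWeakNhds g, h ∈ S := by
    have h1 : ∃ᶠ h in posWeakNhds g, δ < ‖T h - T g‖ := by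
      intro hev
      simp only [not_lt] at hev
      linarith [hψ g hg, weakOsc_le hδ.le hev]
    have h2 : ∀ᶠ h in posWeakNhds g, ∀ k < n, ‖Q k h - Q k g‖ < η / 2 := by
      refine (Set.finite_Iio n).eventually_all.2 fun k _ => ?_
      filter_upwards [Metric.tendsto_nhds.1 (hQ k g hg hg0) _ (half_pos hη)] with h hh
      rwa [← dist_eq_norm]
    refine (h1.and_eventually (h2.and ((eventually_nonneg_posWeakNhds g).and
      (((tendsto_dual_posWeakNhds ψ g).eventually (Ioi_mem_nhds hψg)).and
      ((tendsto_dual_posWeakNhds mass g).eventually (Iio_mem_nhds hmg)))))).mono ?_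
    rintro h ⟨h1, h2, h3, h4, h5⟩
    exact ⟨h3, h4, h5, h1, h2⟩
  have hsmall : ∀ᶠ ε : ℝ in 𝓝[>] 0, ε < 1 - ‖x - g‖ ∧ ‖T‖ * ε < δ / 2 ∧
      ∀ k < n, ‖Q k‖ * ε < η / 2 := by
    refine Filter.Eventually.filter_mono nhdsWithin_le_nhds ?_
    refine Eventually.and (Iio_mem_nhds (sub_pos.2 hxg)) (Eventually.and ?_
      ((Set.finite_Iio n).eventually_all.2 fun k _ => ?_))
    · exact ((continuous_const.mul continuous_id).tendsto' (0 : ℝ) 0 (by simp)).eventually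
        (Iio_mem_nhds (half_pos hδ))
    · exact ((continuous_const.mul continuous_id).tendsto' (0 : ℝ) 0 (by simp)).eventually
        (Iio_mem_nhds (half_pos hη))
  obtain ⟨ε, ⟨hε1, hεT, hεQ⟩, hε⟩ := (hsmall.and self_mem_nhdsWithin).exists
  obtain ⟨N₀, hN₀, s, hs, hsg⟩ :=
    exists_mean_near (mem_closure_convexHull_of_frequently hfreq) (ε := ε) hε
  set r : L1 := g - (N₀ : ℝ)⁻¹ • ∑ i ∈ Finset.range N₀, s i with hr
  have hy (i : ℕ) : s (i % N₀) + (x - g) + r = x + ((s (i % N₀) - g) + r) := by abel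
  refine ⟨fun i => s (i % N₀) + (x - g) + r, ?_, fun i => ?_, fun i => ?_, fun i k hk => ?_,
    N₀, hN₀, ?_⟩
  · refine ((Finset.range N₀).finite_toSet.image fun i => s i + (x - g) + r).subset ?_
    rintro _ ⟨i, rfl⟩
    exact ⟨i % N₀, by simpa using Nat.mod_lt _ hN₀, rfl⟩
  · obtain ⟨h1, h2, h3, -, -⟩ := hs (i % N₀)
    refine ⟨s (i % N₀), h1, h2, h3, ?_⟩
    dsimp only
    rw [add_assoc, add_sub_cancel_left]
    linarith [norm_add_le (x - g) r]
  · obtain ⟨-, -, -, h4, -⟩ := hs (i % N₀)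
    dsimp only
    rw [hy, map_add, add_sub_cancel_left, map_add, map_sub]
    have h5 := norm_sub_le ((T (s (i % N₀)) - T g) + T r) (T r)
    rw [add_sub_cancel_right] at h5
    linarith [T.le_opNorm_of_le hsg.le]
  · obtain ⟨-, -, -, -, h5⟩ := hs (i % N₀)
    dsimp only
    rw [hy, map_add, add_sub_cancel_left, map_add, map_sub]
    linarith [norm_add_le (Q k (s (i % N₀)) - Q k g) (Q k r), h5 k hk, (Q k).le_opNorm_of_le hsg.le, hεQ k hk]
  · rintro _ ⟨m, rfl⟩
    have hN₀' : (N₀ : ℝ) ≠ 0 := by positivity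
    have hone : ∑ i ∈ Finset.range N₀, s i = N₀ • (g - r) := by
      rw [hr, sub_sub_cancel, ← Nat.cast_smul_eq_nsmul ℝ, smul_inv_smul₀ hN₀']
    have hper : ∑ i ∈ Finset.range N₀, (s (i % N₀) + (x - g) + r) = N₀ • x := by
      rw [Finset.sum_congr rfl fun i hi => by rw [Nat.mod_eq_of_lt (Finset.mem_range.1 hi)],
        Finset.sum_add_distrib, Finset.sum_add_distrib, hone]
      simp only [Finset.sum_const, Finset.card_range, ← smul_add]
      congr 1
      abel
    induction m with
    | zero => simp
    | succ m ih =>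
      rw [Nat.mul_succ, Finset.sum_range_add, ih, add_smul]
      congr 1
      rw [← hper]
      exact Finset.sum_congr rfl fun i _ => by rw [Nat.mul_add_mod]

end Splitting

/-! ### Uniformly branching trees -/

/-- A tree in a vector space: the node `j` at level `n` is the arithmetic mean of its `N n ≥ 2`
children `j * N n, …, j * N n + (N n - 1)` at level `n + 1`. -/
structure IsMeanTree {E : Type*} [AddCommMonoid E] (N : ℕ → ℕ) (x : ℕ → ℕ → E) : Prop where
  two_le : ∀ n, 2 ≤ N n
  sum_children : ∀ n j, ∑ i ∈ Finset.range (N n), x (n + 1) (j * N n + i) = N n • x n j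

section Tree

variable {X : Type*} [NormedAddCommGroup X] [NormedSpace ℝ X]
  {Y : ℕ → Type*} [∀ k, NormedAddCommGroup (Y k)] [∀ k, NormedSpace ℝ (Y k)]

theorem exists_next_level {T : L1 →L[ℝ] X} {Q : ∀ k, L1 →L[ℝ] Y k} {ψ : L1 →L[ℝ] ℝ} {δ : ℝ}
    (hδ : 0 < δ) (hψ : ∀ h, 0 ≤ h → ψ h ≤ weakOsc T h)
    (hQ : ∀ k f, 0 ≤ f → f ≠ 0 → Tendsto (Q k) (posWeakNhds f) (𝓝 (Q k f)))
    {x : ℕ → L1} (hfin : (Set.range x).Finite) (hx : ∀ j, x j ∈ treeNodes ψ δ) (n : ℕ) {η : ℝ}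
    (hη : 0 < η) :
    ∃ (N : ℕ) (y : ℕ → L1), (Set.range y).Finite ∧ (∀ j, y j ∈ treeNodes ψ δ) ∧ 2 ≤ N ∧
      (∀ j, ∑ i ∈ Finset.range N, y (j * N + i) = N • x j) ∧
      (∀ j, δ / 2 ≤ ‖T (y j) - T (x (j / N))‖) ∧
      ∀ j, ∀ k < n, ‖Q k (y j) - Q k (x (j / N))‖ ≤ η := by
  choose! y hyfin hynode hyT hyQ N₀ hN₀ hysum using
    fun v (hv : v ∈ treeNodes ψ δ) => exists_splitting hδ hψ hQ hv n hη
  set N := 2 * ∏ v ∈ hfin.toFinset, N₀ v with hN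
  have hprod : 0 < ∏ v ∈ hfin.toFinset, N₀ v := Finset.prod_pos fun v hv => by
    obtain ⟨j, rfl⟩ := hfin.mem_toFinset.1 hv
    exact hN₀ _ (hx j)
  have hN2 : 2 ≤ N := by omega
  have hdvd (j : ℕ) : N₀ (x j) ∣ N :=
    (Finset.dvd_prod_of_mem N₀ (hfin.mem_toFinset.2 ⟨j, rfl⟩)).mul_left 2
  refine ⟨N, fun j => y (x (j / N)) (j % N), ?_, fun j => hynode _ (hx _) _, hN2, fun j => ?_,
    fun j => hyT _ (hx _) _, fun j => hyQ _ (hx _) _⟩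
  · refine (hfin.biUnion fun v hv => ?_).subset (s := ⋃ v ∈ Set.range x, Set.range (y v)) ?_
    · obtain ⟨j, rfl⟩ := hv
      exact hyfin _ (hx j)
    · rintro _ ⟨j, rfl⟩
      exact Set.mem_biUnion ⟨j / N, rfl⟩ ⟨j % N, rfl⟩
  · rw [← hysum _ (hx j) N (hdvd j)]
    refine Finset.sum_congr rfl fun i hi => ?_
    have hi : i < N := Finset.mem_range.1 hi
    have h1 : (j * N + i) / N = j := by
      rw [mul_comm, Nat.mul_add_div (by omega), Nat.div_eq_of_lt hi, add_zero]
    have h2 : (j * N + i) % N = i := by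
      rw [mul_comm, Nat.mul_add_mod, Nat.mod_eq_of_lt hi]
    simp only [h1, h2]

theorem exists_separated_tree {T : L1 →L[ℝ] X} {Q : ∀ k, L1 →L[ℝ] Y k} {ψ : L1 →L[ℝ] ℝ} {δ : ℝ}
    (hδ : 0 < δ) (hψ : ∀ h, 0 ≤ h → ψ h ≤ weakOsc T h)
    (hQ : ∀ k f, 0 ≤ f → f ≠ 0 → Tendsto (Q k) (posWeakNhds f) (𝓝 (Q k f)))
    {x₀ : L1} (hx₀ : x₀ ∈ treeNodes ψ δ) :
    ∃ (N : ℕ → ℕ) (x : ℕ → ℕ → L1), IsMeanTree N x ∧ (∀ n j, x n j ∈ treeNodes ψ δ) ∧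
      (∀ n j, δ / 2 ≤ ‖T (x (n + 1) j) - T (x n (j / N n))‖) ∧
      ∀ n j, ∀ k < n, ‖Q k (x (n + 1) j) - Q k (x n (j / N n))‖ ≤ (1 / 2) ^ n := by
  let L := {x : ℕ → L1 // (Set.range x).Finite ∧ ∀ j, x j ∈ treeNodes ψ δ}
  choose N y hyfin hynode hN hysum hyT hyQ using fun (n : ℕ) (x : L) =>
    exists_next_level hδ hψ hQ x.2.1 x.2.2 n (η := (1 / 2) ^ n) (by positivity)
  let x : ℕ → L := fun n => Nat.rec
    ⟨fun _ => x₀, (Set.finite_singleton x₀).subset Set.range_const_subset, fun _ => hx₀⟩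
    (fun n x => ⟨y n x, hyfin n x, hynode n x⟩) n
  exact ⟨fun n => N n (x n), fun n => (x n).1, ⟨fun n => hN n (x n), fun n => hysum n (x n)⟩,
    fun n => (x n).2.2, fun n => hyT n (x n), fun n => hyQ n (x n)⟩

end Tree

/-! ### Functions that are constant on the cells of a grid -/

section Grid

variable {E : Type*} [NormedAddCommGroup E]

/-- The function taking the value `s j` on `[j / M, (j + 1) / M)`. -/
noncomputable def gridFun (M : ℕ) (s : ℕ → E) (t : ℝ) : E := s ⌊t * M⌋₊

/-- The open interval `(j / M, (j + 1) / M)`. -/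
def gridCell (M j : ℕ) : Set ℝ := Set.Ioo (j / M) ((j + 1) / M)

theorem measurableSet_gridCell (M j : ℕ) : MeasurableSet (gridCell M j) := measurableSet_Ioo

theorem gridCell_one_zero : gridCell 1 0 = Set.Ioo 0 1 := by simp [gridCell]

omit [NormedAddCommGroup E] in
theorem gridFun_eq_of_mem {M j : ℕ} (hM : 0 < M) (s : ℕ → E) {t : ℝ} (ht : t ∈ gridCell M j) :
    gridFun M s t = s j := by
  have hM' : (0 : ℝ) < M := by exact_mod_cast hM
  obtain ⟨h1, h2⟩ := ht
  rw [div_lt_iff₀ hM'] at h1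
  rw [lt_div_iff₀ hM'] at h2
  rw [gridFun, (Nat.floor_eq_iff ((Nat.cast_nonneg j).trans h1.le)).2 ⟨h1.le, h2⟩]

omit [NormedAddCommGroup E] in
theorem gridFun_refine {M N : ℕ} (hN : 0 < N) (s : ℕ → E) :
    gridFun M s = gridFun (M * N) fun j => s (j / N) := by
  funext t
  have hN' : (N : ℝ) ≠ 0 := by positivity
  rw [gridFun, gridFun, ← Nat.floor_div_natCast, Nat.cast_mul, ← mul_assoc,
    mul_div_cancel_right₀ _ hN']

theorem stronglyMeasurable_gridFun (M : ℕ) (s : ℕ → E) : StronglyMeasurable (gridFun M s) :=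
  (StronglyMeasurable.of_discrete (f := s)).comp_measurable
    (Nat.measurable_floor.comp (measurable_id.mul_const _))

theorem integrableOn_gridFun {M : ℕ} {s : ℕ → E} {C : ℝ} (hs : ∀ j, ‖s j‖ ≤ C) (a b : ℝ) :
    IntegrableOn (gridFun M s) (Set.Ioo a b) :=
  Measure.integrableOn_of_bounded (M := C) (by simp)
    (stronglyMeasurable_gridFun M s).aestronglyMeasurable (.of_forall fun _ => hs _)

theorem gridCell_subset {M : ℕ} {j : ℕ} (hj : j < M) : gridCell M j ⊆ Set.Ioo 0 1 := by
  have hM' : (0 : ℝ) < M := by exact_mod_cast Nat.zero_lt_of_lt hj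
  refine Set.Ioo_subset_Ioo (by positivity) ?_
  rw [div_le_one hM']
  exact_mod_cast hj

theorem measureReal_gridCell (M j : ℕ) : volume.real (gridCell M j) = (M : ℝ)⁻¹ := by
  rw [gridCell, Real.volume_real_Ioo_of_le (by gcongr; linarith)]
  ring

variable [NormedSpace ℝ E]

theorem setIntegral_gridCell (M j : ℕ) (F : ℝ → E) :
    ∫ t in gridCell M j, F t = ∫ t in (j / M : ℝ)..((j + 1) / M : ℝ), F t := by
  rw [intervalIntegral.integral_of_le (by gcongr; linarith), integral_Ioc_eq_integral_Ioo]
  rfl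

theorem setIntegral_gridCell_eq_sum {M N j : ℕ} (hM : 0 < M) (hN : 0 < N) {F : ℝ → E}
    (hF : IntegrableOn F (gridCell M j)) :
    ∫ t in gridCell M j, F t = ∑ i ∈ Finset.range N, ∫ t in gridCell (M * N) (j * N + i), F t := by
  have hM' : (0 : ℝ) < M := by exact_mod_cast hM
  have hN' : (0 : ℝ) < N := by exact_mod_cast hN
  let a : ℕ → ℝ := fun i => ((j * N + i : ℕ) : ℝ) / (M * N : ℕ)
  have ha0 : a 0 = j / M := by simp only [a]; push_cast; field_simp; simp
  have haN : a N = (j + 1) / M := by simp only [a]; push_cast; field_simp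
  have hmono : Monotone a := fun i k hik => by simp only [a]; gcongr
  have hint : IntervalIntegrable F volume (a 0) (a N) := by
    rw [intervalIntegrable_iff_integrableOn_Ioo_of_le (hmono (zero_le)), ha0, haN]
    exact hF
  have h := intervalIntegral.sum_integral_adjacent_intervals (f := F) (μ := volume) (a := a)
    (n := N) fun k hk => hint.mono_set (by
      rw [Set.uIcc_of_le (hmono k.le_succ), Set.uIcc_of_le (hmono zero_le)]
      exact Set.Icc_subset_Icc (hmono zero_le) (hmono hk))
  rw [setIntegral_gridCell, ← ha0, ← haN, ← h]
  refine Finset.sum_congr rfl fun i _ => ?_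
  rw [setIntegral_gridCell]
  simp only [a]
  push_cast
  rw [add_assoc]

theorem setIntegral_unit_eq_sum {M : ℕ} (hM : 0 < M) {F : ℝ → E}
    (hF : IntegrableOn F (Set.Ioo 0 1)) :
    ∫ t in Set.Ioo 0 1, F t = ∑ j ∈ Finset.range M, ∫ t in gridCell M j, F t := by
  rw [← gridCell_one_zero] at hF ⊢
  rw [setIntegral_gridCell_eq_sum one_pos hM hF]
  simp

theorem setIntegral_gridCell_gridFun {M : ℕ} (hM : 0 < M) (j : ℕ) (s : ℕ → E) [CompleteSpace E] :
    ∫ t in gridCell M j, gridFun M s t = (M : ℝ)⁻¹ • s j := by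
  rw [setIntegral_congr_fun (measurableSet_gridCell M j) fun t ht => gridFun_eq_of_mem hM s ht,
    setIntegral_const, measureReal_gridCell]

theorem exists_gridFun_near {M : ℕ → ℕ} (hM : Tendsto M atTop atTop) {f : ℝ → E}
    (hf : IntegrableOn f (Set.Ioo 0 1)) {ε : ℝ} (hε : 0 < ε) :
    ∃ (n : ℕ) (s : ℕ → E) (B : ℝ), (∀ j, ‖s j‖ ≤ B) ∧
      ∫ t in Set.Ioo 0 1, ‖f t - gridFun (M n) s t‖ ≤ ε := by
  obtain ⟨c, hc, hfc, hcont, hcint⟩ :=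
    Integrable.exists_hasCompactSupport_integral_sub_le hf (half_pos hε)
  obtain ⟨B, hB⟩ := hc.exists_bound_of_continuous hcont
  obtain ⟨δ, hδ, hcδ⟩ := Metric.uniformContinuous_iff.1
    (hc.uniformContinuous_of_continuous hcont) (ε / 2) (half_pos hε)
  obtain ⟨n, hn⟩ := ((tendsto_natCast_atTop_atTop (R := ℝ)).comp hM |>.eventually_gt_atTop
    δ⁻¹).exists
  have hn : δ⁻¹ < M n := hn
  have hMpos : (0 : ℝ) < M n := (inv_pos.2 hδ).trans hn
  have hbound : ∀ j : ℕ, ‖c (j / M n)‖ ≤ B := fun j => hB _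
  refine ⟨n, fun j => c (j / M n), B, hbound, ?_⟩
  have hs := integrableOn_gridFun (M := M n) hbound 0 1
  have hclose : ∀ t ∈ Set.Ioo (0 : ℝ) 1,
      ‖c t - gridFun (M n) (fun j => c (j / M n)) t‖ ≤ ε / 2 := by
    intro t ht
    rw [← dist_eq_norm]
    refine (hcδ ?_).le
    have h0 : 0 ≤ t * M n := mul_nonneg ht.1.le hMpos.le
    have h1 := Nat.floor_le h0
    have h2 := Nat.lt_floor_add_one (t * M n)
    have h3 : (1 : ℝ) < δ * M n := by rwa [inv_lt_iff_one_lt_mul₀' hδ] at hn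
    rw [Real.dist_eq, abs_sub_lt_iff]
    have h4 : t - ⌊t * M n⌋₊ / M n = (t * M n - ⌊t * M n⌋₊) / M n := by field_simp
    have h5 : (⌊t * M n⌋₊ : ℝ) / M n - t = (⌊t * M n⌋₊ - t * M n) / M n := by field_simp
    rw [h4, h5, div_lt_iff₀ hMpos, div_lt_iff₀ hMpos]
    constructor <;> linarith
  calc ∫ t in Set.Ioo 0 1, ‖f t - gridFun (M n) (fun j => c (j / M n)) t‖
      ≤ ∫ t in Set.Ioo (0 : ℝ) 1, (‖f t - c t‖ + ε / 2) := by
        refine setIntegral_mono_on (hf.sub hs).norm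
          ((hf.sub hcint).norm.add (integrable_const _)) measurableSet_Ioo fun t ht => ?_
        exact (norm_sub_le_norm_sub_add_norm_sub _ (c t) _).trans
          (add_le_add le_rfl (hclose t ht))
    _ = (∫ t in Set.Ioo (0 : ℝ) 1, ‖f t - c t‖) + ε / 2 := by
        have hi : Integrable (fun t => ‖f t - c t‖) (volume.restrict (Set.Ioo (0 : ℝ) 1)) :=
          (hf.sub hcint).norm
        rw [integral_add hi (integrable_const _), setIntegral_const]
        simp
    _ ≤ ε := by linarith

/-- Averaging over the cells of a grid does not increase the distance in `L¹` to a function that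
is constant on the cells. -/
theorem sum_norm_average_sub_le [CompleteSpace E] {M : ℕ} (hM : 0 < M) {g : ℝ → E}
    (hg : IntegrableOn g (Set.Ioo 0 1)) {v s : ℕ → E} {B : ℝ} (hs : ∀ j, ‖s j‖ ≤ B)
    (hv : ∀ j < M, (M : ℝ)⁻¹ • v j = ∫ t in gridCell M j, g t) :
    ∑ j ∈ Finset.range M, ‖v j - s j‖ ≤ M * ∫ t in Set.Ioo 0 1, ‖g t - gridFun M s t‖ := by
  have hM' : (0 : ℝ) < M := by exact_mod_cast hM
  have hi : IntegrableOn (fun t => ‖g t - gridFun M s t‖) (Set.Ioo 0 1) :=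
    (hg.sub (integrableOn_gridFun hs 0 1)).norm
  rw [setIntegral_unit_eq_sum hM hi, Finset.mul_sum]
  refine Finset.sum_le_sum fun j hj => ?_
  have hj : j < M := Finset.mem_range.1 hj
  rw [← inv_mul_le_iff₀ hM']
  have h1 : ‖(M : ℝ)⁻¹ • (v j - s j)‖ = (M : ℝ)⁻¹ * ‖v j - s j‖ := by
    rw [norm_smul, Real.norm_of_nonneg (inv_nonneg.2 hM'.le)]
  rw [← h1, smul_sub, hv j hj, ← setIntegral_gridCell_gridFun hM j s,
    ← integral_sub (hg.mono_set (gridCell_subset hj))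
      ((integrableOn_gridFun hs 0 1).mono_set (gridCell_subset hj))]
  exact norm_integral_le_integral_norm _

end Grid

theorem sum_range_mul_div {A : Type*} [AddCommMonoid A] (M : ℕ) {N : ℕ} (hN : 0 < N) (f : ℕ → A) :
    ∑ j ∈ Finset.range (M * N), f (j / N) = N • ∑ j ∈ Finset.range M, f j := by
  induction M with
  | zero => simp
  | succ M ih =>
    rw [Nat.succ_mul, Finset.sum_range_add, ih, Finset.sum_range_succ, smul_add]
    congr 1
    rw [Finset.sum_congr rfl fun i hi => ?_, Finset.sum_const, Finset.card_range]
    rw [mul_comm, Nat.mul_add_div hN, Nat.div_eq_of_lt (Finset.mem_range.1 hi), add_zero]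

/-! ### The operator associated with a bounded tree -/

/-- The number of nodes at level `n` of the tree with branching numbers `N`. -/
def gridSize (N : ℕ → ℕ) (n : ℕ) : ℕ := ∏ i ∈ Finset.range n, N i

theorem gridSize_succ (N : ℕ → ℕ) (n : ℕ) : gridSize N (n + 1) = gridSize N n * N n :=
  Finset.prod_range_succ _ _

theorem two_pow_le_gridSize {N : ℕ → ℕ} (hN : ∀ n, 2 ≤ N n) (n : ℕ) : 2 ^ n ≤ gridSize N n := by
  induction n with
  | zero => simp [gridSize]
  | succ n ih => rw [gridSize_succ, pow_succ]; exact Nat.mul_le_mul ih (hN n)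

theorem gridSize_pos {N : ℕ → ℕ} (hN : ∀ n, 2 ≤ N n) (n : ℕ) : 0 < gridSize N n :=
  (pow_pos two_pos n).trans_le (two_pow_le_gridSize hN n)

theorem tendsto_gridSize {N : ℕ → ℕ} (hN : ∀ n, 2 ≤ N n) : Tendsto (gridSize N) atTop atTop :=
  tendsto_atTop_mono (two_pow_le_gridSize hN) (tendsto_pow_atTop_atTop_of_one_lt one_lt_two)

section TreeOperator

variable {E : Type*} [NormedAddCommGroup E] [NormedSpace ℝ E]

theorem integrable_smul_gridFun (f : L1) (M : ℕ) {s : ℕ → E} {C : ℝ} (hs : ∀ j, ‖s j‖ ≤ C) :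
    Integrable (fun t => f t • gridFun M s t) (volume.restrict (Set.Ioo (0 : ℝ) 1)) :=
  (L1.integrable_coeFn f).smul_bdd C (stronglyMeasurable_gridFun M s).aestronglyMeasurable
    (.of_forall fun _ => hs _)

theorem exists_gridOperator (M : ℕ) {s : ℕ → E} {C : ℝ} (hs : ∀ j, ‖s j‖ ≤ C) :
    ∃ A : L1 →L[ℝ] E, ∀ f, A f = ∫ t in Set.Ioo (0 : ℝ) 1, f t • gridFun M s t := by
  refine ⟨LinearMap.mkContinuous
    { toFun := fun f => ∫ t in Set.Ioo (0 : ℝ) 1, f t • gridFun M s t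
      map_add' := fun f g => ?_
      map_smul' := fun c f => ?_ } C fun f => ?_, fun f => rfl⟩
  · rw [← integral_add (integrable_smul_gridFun f M hs) (integrable_smul_gridFun g M hs)]
    refine integral_congr_ae ?_
    filter_upwards [Lp.coeFn_add f g] with t ht
    rw [ht, Pi.add_apply, add_smul]
  · rw [← integral_smul]
    refine integral_congr_ae ?_
    filter_upwards [Lp.coeFn_smul c f] with t ht
    rw [ht, Pi.smul_apply, smul_eq_mul, mul_smul, RingHom.id_apply]
  · rw [L1.norm_eq_integral_norm, ← integral_const_mul]
    refine norm_integral_le_of_norm_le ((L1.integrable_coeFn f).norm.const_mul C)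
      (.of_forall fun t => ?_)
    rw [norm_smul, mul_comm]
    exact mul_le_mul_of_nonneg_right (hs _) (norm_nonneg _)

variable [CompleteSpace E] {N : ℕ → ℕ} {x : ℕ → ℕ → E}

theorem IsMeanTree.setIntegral_gridCell (hx : IsMeanTree N x) {C : ℝ} (hC : ∀ n j, ‖x n j‖ ≤ C)
    (d n j : ℕ) : ∫ t in gridCell (gridSize N n) j, gridFun (gridSize N (n + d)) (x (n + d)) t =
      (gridSize N n : ℝ)⁻¹ • x n j := by
  induction d generalizing n j with
  | zero => exact setIntegral_gridCell_gridFun (gridSize_pos hx.two_le n) j _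
  | succ d ih =>
    have hN : 0 < N n := two_pos.trans_le (hx.two_le n)
    have hN' : (N n : ℝ) ≠ 0 := by positivity
    rw [setIntegral_gridCell_eq_sum (gridSize_pos hx.two_le n) hN
      (integrableOn_gridFun (hC _) _ _), ← gridSize_succ, show n + (d + 1) = n + 1 + d by ring]
    simp only [ih]
    rw [← Finset.smul_sum, hx.sum_children, gridSize_succ, ← Nat.cast_smul_eq_nsmul ℝ, smul_smul]
    congr 1
    push_cast
    field_simp

theorem IsMeanTree.integral_gridFun_smul (hx : IsMeanTree N x) {C : ℝ} (hC : ∀ n j, ‖x n j‖ ≤ C)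
    (n d : ℕ) {s : ℕ → ℝ} {B : ℝ} (hs : ∀ j, ‖s j‖ ≤ B) :
    ∫ t in Set.Ioo (0 : ℝ) 1, gridFun (gridSize N n) s t •
        gridFun (gridSize N (n + d)) (x (n + d)) t =
      ∑ j ∈ Finset.range (gridSize N n), s j • (gridSize N n : ℝ)⁻¹ • x n j := by
  have hpos := gridSize_pos hx.two_le n
  rw [setIntegral_unit_eq_sum hpos]
  · refine Finset.sum_congr rfl fun j _ => ?_
    rw [← hx.setIntegral_gridCell hC d n j, ← integral_smul]
    refine setIntegral_congr_fun (measurableSet_gridCell _ j) fun t ht => ?_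
    simp only [gridFun_eq_of_mem hpos s ht]
  · exact Integrable.smul_bdd (integrableOn_gridFun hs 0 1) C
      (stronglyMeasurable_gridFun _ _).aestronglyMeasurable (.of_forall fun _ => hC _ _)

/-- A bounded tree defines an operator on `L¹(0,1)`, the limit of the operators represented by the
levels of the tree. -/
theorem IsMeanTree.exists_operator (hx : IsMeanTree N x) {C : ℝ} (hC : ∀ n j, ‖x n j‖ ≤ C) :
    ∃ D : L1 →L[ℝ] E, ∀ f, Tendsto
      (fun m => ∫ t in Set.Ioo (0 : ℝ) 1, f t • gridFun (gridSize N m) (x m) t) atTop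
      (𝓝 (D f)) := by
  choose A hA using fun m => exists_gridOperator (gridSize N m) (hC m)
  have hC0 : 0 ≤ C := (norm_nonneg _).trans (hC 0 0)
  have hcauchy (f : L1) : CauchySeq fun m => A m f := by
    refine Metric.cauchySeq_iff'.2 fun ε hε => ?_
    obtain ⟨η, hη, hηε⟩ : ∃ η : ℝ, 0 < η ∧ 2 * (C * η) < ε := by
      refine ⟨ε / (4 * (C + 1)), by positivity, ?_⟩
      rw [← mul_assoc, mul_div_assoc', div_lt_iff₀ (by positivity)]
      nlinarith
    obtain ⟨n, s, B, hs, hfs⟩ :=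
      exists_gridFun_near (tendsto_gridSize hx.two_le) (L1.integrable_coeFn f) hη
    have hnear (d : ℕ) : ‖A (n + d) f -
        ∑ j ∈ Finset.range (gridSize N n), s j • (gridSize N n : ℝ)⁻¹ • x n j‖ ≤ C * η := by
      have hint : Integrable (fun t => gridFun (gridSize N n) s t •
          gridFun (gridSize N (n + d)) (x (n + d)) t) (volume.restrict (Set.Ioo (0 : ℝ) 1)) :=
        Integrable.smul_bdd (integrableOn_gridFun hs 0 1) C
          (stronglyMeasurable_gridFun _ _).aestronglyMeasurable (.of_forall fun _ => hC _ _)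
      have hdiff : Integrable (fun t => ‖f t - gridFun (gridSize N n) s t‖)
          (volume.restrict (Set.Ioo (0 : ℝ) 1)) :=
        ((L1.integrable_coeFn f).sub (integrableOn_gridFun hs 0 1)).norm
      rw [← hx.integral_gridFun_smul hC n d hs, hA,
        ← integral_sub (integrable_smul_gridFun f _ (hC _)) hint]
      refine (norm_integral_le_of_norm_le (hdiff.const_mul C) (.of_forall fun t => ?_)).trans ?_
      · rw [← sub_smul, norm_smul, mul_comm]
        exact mul_le_mul_of_nonneg_right (hC _ _) (norm_nonneg _)
      · rw [integral_const_mul]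
        exact mul_le_mul_of_nonneg_left hfs hC0
    refine ⟨n, fun m hm => ?_⟩
    obtain ⟨d, rfl⟩ := Nat.exists_eq_add_of_le hm
    have h0 := hnear 0
    rw [add_zero] at h0
    rw [dist_eq_norm]
    refine lt_of_le_of_lt ((norm_sub_le_norm_sub_add_norm_sub _ _ _).trans
      (add_le_add (hnear d) ((norm_sub_rev _ _).trans_le h0))) ?_
    linarith
  choose D hD using fun f => cauchySeq_tendsto_of_complete (hcauchy f)
  refine ⟨continuousLinearMapOfTendsto A (tendsto_pi_nhds.2 hD), fun f => ?_⟩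
  simp only [← hA]
  exact hD f

/-- The indicator function of a cell. -/
noncomputable def cellIndicator (M j : ℕ) : L1 :=
  indicatorConstLp 1 (measurableSet_gridCell M j) (measure_ne_top _ _) 1

omit [CompleteSpace E] in
theorem integral_cellIndicator_smul {M j : ℕ} (hj : j < M) (h : ℝ → E) :
    ∫ t in Set.Ioo (0 : ℝ) 1, cellIndicator M j t • h t = ∫ t in gridCell M j, h t := by
  rw [← Set.inter_eq_self_of_subset_right (gridCell_subset hj),
    ← setIntegral_indicator (measurableSet_gridCell M j)]
  refine integral_congr_ae ?_
  filter_upwards [indicatorConstLp_coeFn (p := 1) (hs := measurableSet_gridCell M j)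
    (hμs := measure_ne_top (volume.restrict (Set.Ioo (0 : ℝ) 1)) _) (c := (1 : ℝ))] with t ht
  rw [cellIndicator, ht]
  by_cases hmem : t ∈ gridCell M j <;> simp [hmem]

theorem IsMeanTree.operator_cellIndicator (hx : IsMeanTree N x) {C : ℝ}
    (hC : ∀ n j, ‖x n j‖ ≤ C) {D : L1 →L[ℝ] E}
    (hD : ∀ f, Tendsto
      (fun m => ∫ t in Set.Ioo (0 : ℝ) 1, f t • gridFun (gridSize N m) (x m) t) atTop (𝓝 (D f)))
    {n j : ℕ} (hj : j < gridSize N n) :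
    D (cellIndicator (gridSize N n) j) = (gridSize N n : ℝ)⁻¹ • x n j := by
  refine tendsto_nhds_unique (hD _) (tendsto_const_nhds.congr' ?_)
  filter_upwards [eventually_ge_atTop n] with m hm
  obtain ⟨d, rfl⟩ := Nat.exists_eq_add_of_le hm
  rw [integral_cellIndicator_smul hj, hx.setIntegral_gridCell hC]

variable {Y : Type*} [NormedAddCommGroup Y] [NormedSpace ℝ Y] [CompleteSpace Y]

/-- An operator that separates each node of the tree from its children is not representable when
composed with the operator defined by the tree. -/
theorem IsMeanTree.not_isRepresentable_comp (hx : IsMeanTree N x) {C : ℝ}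
    (hC : ∀ n j, ‖x n j‖ ≤ C) {D : L1 →L[ℝ] E}
    (hD : ∀ f, Tendsto
      (fun m => ∫ t in Set.Ioo (0 : ℝ) 1, f t • gridFun (gridSize N m) (x m) t) atTop (𝓝 (D f)))
    (T : E →L[ℝ] Y) {δ : ℝ} (hδ : 0 < δ)
    (hT : ∀ n j, δ ≤ ‖T (x (n + 1) j) - T (x n (j / N n))‖) : ¬ IsRepresentable (T.comp D) := by
  rintro ⟨g, hg⟩
  have hgint : IntegrableOn g (Set.Ioo 0 1) := (Lp.memLp g).integrable le_top
  have hval (m j : ℕ) (hj : j < gridSize N m) :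
      (gridSize N m : ℝ)⁻¹ • T (x m j) = ∫ t in gridCell (gridSize N m) j, g t := by
    rw [← integral_cellIndicator_smul hj, ← hg, ContinuousLinearMap.comp_apply,
      hx.operator_cellIndicator hC hD hj, map_smul]
  obtain ⟨n, s, B, hs, hgs⟩ := exists_gridFun_near (tendsto_gridSize hx.two_le) hgint
    (show 0 < δ / 4 by positivity)
  have hN : 0 < N n := two_pos.trans_le (hx.two_le n)
  have hpos := gridSize_pos hx.two_le n
  have h1 := sum_norm_average_sub_le hpos hgint hs (hval n)
  have h2 := sum_norm_average_sub_le (gridSize_pos hx.two_le (n + 1)) hgint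
    (s := fun j => s (j / N n)) (fun j => hs _) (hval (n + 1))
  rw [gridSize_succ, ← gridFun_refine hN] at h2
  have h3 : ∑ j ∈ Finset.range (gridSize N n * N n), δ ≤
      ∑ j ∈ Finset.range (gridSize N n * N n), ‖T (x (n + 1) j) - s (j / N n)‖ +
      ∑ j ∈ Finset.range (gridSize N n * N n), ‖T (x n (j / N n)) - s (j / N n)‖ := by
    rw [← Finset.sum_add_distrib]
    refine Finset.sum_le_sum fun j _ => (hT n j).trans ?_
    rw [norm_sub_rev (T (x n (j / N n)))]
    exact norm_sub_le_norm_sub_add_norm_sub _ _ _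
  rw [sum_range_mul_div (gridSize N n) hN fun j => ‖T (x n j) - s j‖, Finset.sum_const,
    Finset.card_range, nsmul_eq_mul, nsmul_eq_mul] at h3
  have hK : (0 : ℝ) < (gridSize N n * N n : ℕ) := by positivity
  have h4 : (N n : ℝ) * ∑ j ∈ Finset.range (gridSize N n), ‖T (x n j) - s j‖ ≤
      (gridSize N n * N n : ℕ) * (δ / 4) := by
    push_cast
    calc _ ≤ (N n : ℝ) * (gridSize N n * (δ / 4)) := by gcongr; exact h1.trans (by gcongr)
      _ = _ := by ring
  have h5 := h2.trans (mul_le_mul_of_nonneg_left hgs hK.le)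
  nlinarith

/-- An operator under which the branches of the tree converge geometrically is representable when
composed with the operator defined by the tree. -/
theorem IsMeanTree.isRepresentable_comp (hx : IsMeanTree N x) {C : ℝ}
    (hC : ∀ n j, ‖x n j‖ ≤ C) {D : L1 →L[ℝ] E}
    (hD : ∀ f, Tendsto
      (fun m => ∫ t in Set.Ioo (0 : ℝ) 1, f t • gridFun (gridSize N m) (x m) t) atTop (𝓝 (D f)))
    (Q : E →L[ℝ] Y) {k : ℕ}
    (hQ : ∀ n j, k < n → ‖Q (x (n + 1) j) - Q (x n (j / N n))‖ ≤ (1 / 2) ^ n) :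
    IsRepresentable (Q.comp D) := by
  let φ : ℕ → ℝ → Y := fun m => gridFun (gridSize N m) fun j => Q (x m j)
  have hstep (m : ℕ) (hm : k < m) (t : ℝ) : ‖φ (m + 1) t - φ m t‖ ≤ (1 / 2) ^ m := by
    have e : φ m = gridFun (gridSize N (m + 1)) fun j => Q (x m (j / N m)) := by
      rw [gridSize_succ]
      exact gridFun_refine (two_pos.trans_le (hx.two_le m)) _
    rw [e]
    exact hQ m _ hm
  have hcauchy (t : ℝ) : ∃ y, Tendsto (fun m => φ m t) atTop (𝓝 y) := by
    have hc : CauchySeq fun m => φ (m + (k + 1)) t := by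
      refine cauchySeq_of_le_geometric (1 / 2) 1 (by norm_num) fun m => ?_
      rw [dist_eq_norm, norm_sub_rev, one_mul, add_right_comm]
      exact (hstep _ (by omega) t).trans
        (pow_le_pow_of_le_one (by norm_num) (by norm_num) (by omega))
    obtain ⟨y, hy⟩ := cauchySeq_tendsto_of_complete hc
    exact ⟨y, (tendsto_add_atTop_iff_nat (k + 1)).1 hy⟩
  choose γ hγ using hcauchy
  have hφbound (m : ℕ) (t : ℝ) : ‖φ m t‖ ≤ ‖Q‖ * C := Q.le_opNorm_of_le (hC _ _)
  have hγmeas : StronglyMeasurable γ := stronglyMeasurable_of_tendsto atTop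
    (fun m => stronglyMeasurable_gridFun _ _) (tendsto_pi_nhds.2 hγ)
  have hγbound (t : ℝ) : ‖γ t‖ ≤ ‖Q‖ * C :=
    le_of_tendsto (hγ t).norm (.of_forall fun m => hφbound m t)
  have hmem : MemLp γ ⊤ (volume.restrict (Set.Ioo (0 : ℝ) 1)) :=
    memLp_top_of_bound hγmeas.aestronglyMeasurable _ (.of_forall hγbound)
  refine ⟨hmem.toLp, fun f => ?_⟩
  have hγint : ∫ t in Set.Ioo (0 : ℝ) 1, f t • hmem.toLp γ t =
      ∫ t in Set.Ioo (0 : ℝ) 1, f t • γ t := by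
    refine integral_congr_ae ?_
    filter_upwards [hmem.coeFn_toLp] with t ht
    rw [ht]
  rw [hγint]
  have h1 : Tendsto (fun m => ∫ t in Set.Ioo (0 : ℝ) 1, f t • φ m t) atTop
      (𝓝 (Q (D f))) := by
    refine ((Q.continuous.tendsto _).comp (hD f)).congr fun m => ?_
    rw [Function.comp_apply, ← Q.integral_comp_comm (integrable_smul_gridFun f _ (hC m))]
    simp only [map_smul]
    rfl
  refine tendsto_nhds_unique h1 (tendsto_integral_of_dominated_convergence
    (fun t => ‖Q‖ * C * ‖f t‖) (fun m => ?_) ((L1.integrable_coeFn f).norm.const_mul _)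
    (fun m => .of_forall fun t => ?_) (.of_forall fun t => (hγ t).const_smul (f t)))
  · exact (Lp.aestronglyMeasurable f).smul (stronglyMeasurable_gridFun _ _).aestronglyMeasurable
  · rw [norm_smul, mul_comm]
    exact mul_le_mul_of_nonneg_right (hφbound m t) (norm_nonneg _)

end TreeOperator

theorem proposition1p1 {X : Type*} [NormedAddCommGroup X] [NormedSpace ℝ X] [CompleteSpace X]
    (V : ℕ → Submodule ℝ X) (hV : IsSchauderDecomposition V)
    (T : L1 →L[ℝ] X) (hT : ¬ IsStronglyRegular T)
    (hPT : ∀ n, IsStronglyRegular ((hV.proj n).comp T)) :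
    ∃ D : L1 →L[ℝ] L1,
      ¬ IsRepresentable (T.comp D) ∧
      ∀ n, IsRepresentable ((hV.proj n).comp (T.comp D)) := by
  have hcomplete (k : ℕ) : CompleteSpace (V k) := (hV.isClosed k).completeSpace_coe
  obtain ⟨f, hf, hosc⟩ := exists_weakOsc_pos hT
  obtain ⟨hf0, hf1⟩ := mem_densities_iff.1 hf
  obtain ⟨ψ, hψf, hψ⟩ := exists_dual_le_weakOsc T hf0 hosc
  have hδ : 0 < weakOsc T f / 2 := half_pos hosc
  have hnode : f ∈ treeNodes ψ (weakOsc T f / 2) :=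
    ⟨f, hf0, hψf.symm ▸ half_lt_self hosc, by rw [hf1]; exact one_lt_two, by simp⟩
  obtain ⟨N, x, hx, hxnode, hxT, hxP⟩ := exists_separated_tree hδ hψ
    (fun k g hg hg0 => (hPT k).tendsto_posWeakNhds hg hg0) hnode
  have hbound (n j : ℕ) : ‖x n j‖ ≤ 3 := norm_le_of_mem_treeNodes (hxnode n j)
  obtain ⟨D, hD⟩ := hx.exists_operator hbound
  refine ⟨D, hx.not_isRepresentable_comp hbound hD T (half_pos hδ) hxT, fun k => ?_⟩
  exact hx.isRepresentable_comp hbound hD ((hV.proj k).comp T) (k := k)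
    fun n j hn => hxP n j k hn
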